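/- Let $\mathbb{F}_q$ be a finite field with $q$ elements, and let $V$ and $W$ be vector spaces over $\mathbb{F}_q$ of finite dimensions $m$ and $n$ respectively. Let $\mathcal{N}(V,W)$ be the set of nilpotent pairs, i.e. of pairs $(f,g)\in \mathrm{Hom}(V,W)\times \mathrm{Hom}(W,V)$ of linear maps such that $gf$ is a nilpotent endomorphism of $V$. Let $V\cup_0 W$ be the union of $V$ and $W$ along their zero vectors, regarded as the subset $(V\oplus 0)\cup(0\oplus W)$ of $V\oplus W$. Then there is a bijection $$\mathrm{Hom}(V,W)\times \mathrm{Hom}(W,V)\times (V\cup_0 W)\;\cong\;\mathcal{N}(V,W)\times V\times W,$$ and the number of nilpotent pairs is $$|\mathcal{N}(V,W)| = q^{2mn-m-n}\,(q^m+q^n-1).$$ -/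

import Mathlib

/-- The set of nilpotent pairs for `V` and `W`: the pairs `(f, g)` of linear maps `f : V → W` and
`g : W → V` whose composite `g ∘ f` is a nilpotent endomorphism of `V`. -/
def nilpotentPairs (F V W : Type*) [Field F] [AddCommGroup V] [Module F V]
    [AddCommGroup W] [Module F W] : Set ((V →ₗ[F] W) × (W →ₗ[F] V)) :=
  {p | IsNilpotent (p.2 ∘ₗ p.1 : Module.End F V)}

/-- The union of `V` and `W` along their zero vectors, as a subset of `V ⊕ W`: the union of the
two summands `V ⊕ 0` and `0 ⊕ W`, which meet exactly in the zero vector. -/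
def unionAlongZero (F V W : Type*) [Field F] [AddCommGroup V] [Module F V]
    [AddCommGroup W] [Module F W] : Set (V × W) :=
  Set.range (LinearMap.inl F V W) ∪ Set.range (LinearMap.inr F V W)

/-!
Since all the sets involved are finite, the bijection amounts to the equality
`|N(V, W)| * |V| * |W| = |Hom(V, W)| * |Hom(W, V)| * (|V| + |W| - 1)`, which is also the formula for
`|N(V, W)|`.

Fix `f : V → W` with range `I` of dimension `r`. The composite `g ∘ f` is nilpotent exactly when the
endomorphism of `I` induced by `f ∘ g` is. That endomorphism depends linearly on `g`, and every
endomorphism of `I` arises, so the proportion of suitable `g` is the proportion of nilpotent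
endomorphisms of `I`. By the Fine–Herstein theorem (`natCard_isNilpotent_end`) this is
`q ^ (-r) = |ker f| / |V|`; see `natCard_isNilpotent_comp_mul`. Summing over `f` leaves the number of
pairs `(f, v)` with `f v = 0`, which is easily found by summing over `v` first
(`sum_natCard_ker_mul`): all `f` qualify for `v = 0`, and a proportion `1 / |W|` for `v ≠ 0`.

The Fine–Herstein theorem is proved by induction on the dimension `n`. For linearly independent
`e 0, …, e j` it is shown that `q ^ (n * (n - j - 1))` nilpotent endomorphisms `T` satisfy
`T (e i) = e (i + 1)` for `i < j`; the theorem is the case of a single nonzero vector. This goes by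
downward induction on `j`, according to the value `w = T (e j)`. If `w` is outside the span of the
chain, it prolongs the chain. If it is in the span, nilpotency forces `w = 0`
(`MovesAlong.last_eq_zero`), and then `T` is nilpotent exactly when it is so on the quotient by the
span, a space of smaller dimension.
-/

/-! ### Counting by fibres -/

/-- The preimage of a set under a surjective homomorphism of groups has the same density as the
set itself. -/
theorem AddMonoidHom.natCard_preimage_mul {A B : Type*} [AddCommGroup A] [AddCommGroup B]
    (L : A →+ B) (hL : Function.Surjective L) (P : B → Prop) :
    Nat.card {a // P (L a)} * Nat.card B = Nat.card {b // P b} * Nat.card A := by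
  obtain ⟨s, hs⟩ := hL.hasRightInverse
  -- a set-theoretic section `s` of `L` trivializes the fibration
  let e : A ≃ B × L.ker :=
    { toFun := fun a => (L a, ⟨a - s (L a), by simp [AddMonoidHom.mem_ker, hs (L a)]⟩)
      invFun := fun p => s p.1 + p.2
      left_inv := fun a => by simp
      right_inv := fun p => by
        have h : L p.2 = 0 := p.2.2
        ext <;> simp [h, hs p.1] }
  have e₁ : {a // P (L a)} ≃ {b // P b} × L.ker :=
    (e.subtypeEquiv (q := fun p => P p.1) fun a => Iff.rfl).trans
      { toFun := fun p => (⟨p.1.1, p.2⟩, p.1.2)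
        invFun := fun p => ⟨(p.1.1, p.2), p.1.2⟩
        left_inv := fun _ => rfl
        right_inv := fun _ => rfl }
  rw [Nat.card_congr e₁, Nat.card_congr e, Nat.card_prod, Nat.card_prod]
  ring

/-- Classification of the elements of a subtype by the value of a function. -/
theorem natCard_subtype_eq_sum_fiber {A B : Type*} [Finite A] [Fintype B] (φ : A → B)
    (P : A → Prop) : Nat.card {a // P a} = ∑ b, Nat.card {a // P a ∧ φ a = b} := by
  rw [← Nat.card_sigma]
  exact Nat.card_congr
    { toFun := fun a => ⟨φ a.1, a.1, a.2, rfl⟩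
      invFun := fun x => ⟨x.2.1, x.2.2.1⟩
      left_inv := fun _ => rfl
      right_inv := by rintro ⟨_, a, ha, rfl⟩; rfl }

/-! ### Nilpotency criteria -/

section Nilpotent

variable {F V W X : Type*} [Field F] [AddCommGroup V] [Module F V] [AddCommGroup W] [Module F W]
  [AddCommGroup X] [Module F X]

theorem LinearMap.isNilpotent_comp_of_comp_swap (a : V →ₗ[F] W) (b : W →ₗ[F] V)
    (h : IsNilpotent (a ∘ₗ b : Module.End F W)) : IsNilpotent (b ∘ₗ a : Module.End F V) := by
  obtain ⟨k, hk⟩ := h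
  have key : ∀ k : ℕ, ((b ∘ₗ a : Module.End F V) ^ (k + 1)) =
      b ∘ₗ ((a ∘ₗ b : Module.End F W) ^ k) ∘ₗ a := by
    intro k
    induction k with
    | zero => ext; simp
    | succ k ih => rw [pow_succ, ih, pow_succ]; ext; simp
  exact ⟨k + 1, by rw [key, hk]; simp⟩

theorem LinearMap.isNilpotent_comp_swap_iff (a : V →ₗ[F] W) (b : W →ₗ[F] V) :
    IsNilpotent (a ∘ₗ b : Module.End F W) ↔ IsNilpotent (b ∘ₗ a : Module.End F V) :=
  ⟨isNilpotent_comp_of_comp_swap a b, isNilpotent_comp_of_comp_swap b a⟩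

theorem Module.End.isNilpotent_iff_isNilpotent_mapQ (T : Module.End F X) (U : Submodule F X)
    (hU : U ≤ U.comap T) {k : ℕ} (hk : ∀ u ∈ U, (T ^ k) u = 0) :
    IsNilpotent T ↔ IsNilpotent (U.mapQ U T hU : Module.End F (X ⧸ U)) := by
  constructor
  · rintro ⟨l, hl⟩
    refine ⟨l, ?_⟩
    rw [← Submodule.mapQ_pow]
    ext x
    simp [hl]
  · rintro ⟨l, hl⟩
    refine ⟨k + l, ?_⟩
    rw [← Submodule.mapQ_pow] at hl
    ext x
    rw [pow_add, Module.End.mul_apply]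
    refine hk _ ?_
    rw [← Submodule.Quotient.mk_eq_zero, ← Submodule.mapQ_apply U U (T ^ l)
      (h := U.le_comap_pow_of_le_comap hU l), hl]
    rfl

end Nilpotent

/-! ### Endomorphisms moving along a chain of vectors -/

section Chain

variable {F X : Type*} [Field F] [AddCommGroup X] [Module F X] {j : ℕ}

/-- The endomorphism `T` maps each vector of the chain `e 0, …, e j` to the next one. No condition
is put on the image of the last vector. -/
def MovesAlong (e : Fin (j + 1) → X) (T : Module.End F X) : Prop :=
  ∀ i : Fin j, T (e i.castSucc) = e i.succ

theorem movesAlong_snoc_iff (e : Fin (j + 1) → X) (w : X) (T : Module.End F X) :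
    MovesAlong (Fin.snoc (α := fun _ => X) e w) T ↔
      MovesAlong e T ∧ T (e (Fin.last j)) = w := by
  unfold MovesAlong
  rw [Fin.forall_fin_succ']
  simp only [Fin.snoc_castSucc, Fin.succ_last, Fin.snoc_last, Fin.succ_castSucc]

theorem MovesAlong.pow_apply_zero {e : Fin (j + 1) → X} {T : Module.End F X}
    (h : MovesAlong e T) (i : Fin (j + 1)) : (T ^ (i : ℕ)) (e 0) = e i := by
  induction i using Fin.induction with
  | zero => simp
  | succ i ih =>
    rw [Fin.val_succ, pow_succ', Module.End.mul_apply]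
    simp only [Fin.val_castSucc] at ih
    rw [ih, h i]

theorem MovesAlong.span_le_comap {e : Fin (j + 1) → X} {T : Module.End F X}
    (h : MovesAlong e T) (hlast : T (e (Fin.last j)) ∈ Submodule.span F (Set.range e)) :
    Submodule.span F (Set.range e) ≤ (Submodule.span F (Set.range e)).comap T := by
  rw [Submodule.span_le]
  rintro _ ⟨i, rfl⟩
  induction i using Fin.lastCases with
  | last => exact hlast
  | cast i =>
    rw [SetLike.mem_coe, Submodule.mem_comap, h i]
    exact Submodule.subset_span ⟨_, rfl⟩

/-- A nilpotent endomorphism of the `j + 1`-dimensional span of the chain satisfies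
`T ^ (j + 1) = 0` there, so a last image lying in that span vanishes. -/
theorem MovesAlong.last_eq_zero {e : Fin (j + 1) → X} {T : Module.End F X}
    (h : MovesAlong e T) (he : LinearIndependent F e) (hT : IsNilpotent T)
    (hlast : T (e (Fin.last j)) ∈ Submodule.span F (Set.range e)) :
    T (e (Fin.last j)) = 0 := by
  set U := Submodule.span F (Set.range e) with hU
  have hinv : ∀ x ∈ U, T x ∈ U := h.span_le_comap hlast
  have hfr : Module.finrank F U = j + 1 := by
    rw [hU, finrank_span_eq_card he, Fintype.card_fin]
  have : FiniteDimensional F U := FiniteDimensional.span_of_finite F (Set.finite_range e)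
  have hR : IsNilpotent (T.restrict hinv) := by
    obtain ⟨l, hl⟩ := hT
    refine ⟨l, ?_⟩
    rw [Module.End.pow_restrict]
    ext x
    simp [hl]
  have hR' : (T.restrict hinv) ^ (j + 1) = 0 := by
    have := LinearMap.aeval_self_charpoly (T.restrict hinv)
    rw [(LinearMap.charpoly_eq_X_pow_iff _).2 ?_, map_pow, Polynomial.aeval_X, hfr] at this
    · exact this
    · obtain ⟨l, hl⟩ := hR
      exact fun x => ⟨l, by rw [hl]; rfl⟩
  have h0 : e 0 ∈ U := Submodule.subset_span ⟨_, rfl⟩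
  have := congrArg (fun S : Module.End F U => (S ⟨e 0, h0⟩ : X)) hR'
  rw [Module.End.pow_restrict] at this
  rw [← h.pow_apply_zero (Fin.last j), Fin.val_last, ← Module.End.mul_apply, ← pow_succ']
  simpa using this

theorem MovesAlong.pow_apply_eq_zero {e : Fin (j + 1) → X} {T : Module.End F X}
    (h : MovesAlong e T) (hlast : T (e (Fin.last j)) = 0) :
    ∀ u ∈ Submodule.span F (Set.range e), (T ^ (j + 1)) u = 0 := by
  suffices Submodule.span F (Set.range e) ≤ LinearMap.ker (T ^ (j + 1)) from fun u hu => this hu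
  rw [Submodule.span_le]
  rintro _ ⟨i, rfl⟩
  have h0 : (T ^ (j + 1)) (e 0) = 0 := by
    rw [pow_succ', Module.End.mul_apply, ← hlast, ← h.pow_apply_zero (Fin.last j), Fin.val_last]
  simp only [SetLike.mem_coe, LinearMap.mem_ker]
  rw [← h.pow_apply_zero i, ← Module.End.mul_apply, ← pow_add, add_comm, pow_add,
    Module.End.mul_apply, h0, map_zero]

end Chain

/-! ### Counting nilpotent endomorphisms -/

section Count

universe v

variable {F : Type*} [Field F]

/-- Relative to one endomorphism with the prescribed values on the chain, the others differ by a
linear map from the quotient by the span of the chain, and nilpotency is decided on that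
quotient. -/
theorem natCard_isNilpotent_movesAlong_last_eq_zero {X : Type v} [AddCommGroup X] [Module F X]
    [FiniteDimensional F X] {j c : ℕ} (e : Fin (j + 1) → X) (he : LinearIndependent F e)
    (hc : Module.finrank F X = j + 1 + c) :
    Nat.card {T : Module.End F X //
        (IsNilpotent T ∧ MovesAlong e T) ∧ T (e (Fin.last j)) = 0} * Nat.card F ^ (c * c) =
      Nat.card {T : Module.End F (X ⧸ Submodule.span F (Set.range e)) // IsNilpotent T} *
        Nat.card F ^ (c * (j + 1 + c)) := by
  set U := Submodule.span F (Set.range e) with hU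
  have hfr : Module.finrank F U = j + 1 := by
    rw [hU, finrank_span_eq_card he, Fintype.card_fin]
  have hfq : Module.finrank F (X ⧸ U) = c := by
    have := U.finrank_quotient_add_finrank
    omega
  obtain ⟨T₀, hT₀, hT₀'⟩ : ∃ T₀ : Module.End F X, MovesAlong e T₀ ∧ T₀ (e (Fin.last j)) = 0 := by
    let b := Module.Basis.span he
    obtain ⟨T₀, h⟩ := LinearMap.exists_extend
      (b.constr F (Fin.snoc (α := fun _ => X) (fun i : Fin j => e i.succ) 0))
    have hb : ∀ i, T₀ (e i) = Fin.snoc (α := fun _ => X) (fun i : Fin j => e i.succ) 0 i := by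
      intro i
      have := congrArg (fun S => S (b i)) h
      rw [Module.Basis.constr_basis] at this
      simpa [b, Module.Basis.span_apply] using this
    exact ⟨T₀, fun i => by simp [hb], by simp [hb]⟩
  have hinv₀ : U ≤ U.comap T₀ := hT₀.span_le_comap (by rw [hT₀']; exact U.zero_mem)
  let D : Module.End F (X ⧸ U) := U.mapQ U T₀ hinv₀
  let L : ((X ⧸ U) →ₗ[F] X) →ₗ[F] Module.End F (X ⧸ U) := LinearMap.compRight F U.mkQ
  have hL : Function.Surjective L := by
    obtain ⟨s, hs⟩ := U.mkQ.exists_rightInverse_of_surjective U.range_mkQ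
    exact fun S => ⟨s ∘ₗ S, by
      change U.mkQ ∘ₗ s ∘ₗ S = S
      rw [← LinearMap.comp_assoc, hs, LinearMap.id_comp]⟩
  have hmov : ∀ S : (X ⧸ U) →ₗ[F] X, MovesAlong e (T₀ + S ∘ₗ U.mkQ) ∧
      (T₀ + S ∘ₗ U.mkQ) (e (Fin.last j)) = 0 := by
    intro S
    have hz : ∀ i, U.mkQ (e i) = 0 := fun i => by
      simpa using (Submodule.subset_span ⟨i, rfl⟩ : e i ∈ U)
    exact ⟨fun i => by
      rw [LinearMap.add_apply, LinearMap.comp_apply, hz, map_zero, add_zero, hT₀ i], by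
      rw [LinearMap.add_apply, LinearMap.comp_apply, hz, map_zero, add_zero, hT₀']⟩
  have hnil : ∀ S : (X ⧸ U) →ₗ[F] X,
      IsNilpotent (T₀ + S ∘ₗ U.mkQ : Module.End F X) ↔ IsNilpotent (D + L S) := by
    intro S
    obtain ⟨h₁, h₂⟩ := hmov S
    rw [Module.End.isNilpotent_iff_isNilpotent_mapQ _ U
      (h₁.span_le_comap (by rw [h₂]; exact U.zero_mem)) (h₁.pow_apply_eq_zero h₂)]
    have : U.mapQ U (T₀ + S ∘ₗ U.mkQ) (h₁.span_le_comap (by rw [h₂]; exact U.zero_mem)) =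
        D + L S := by
      ext x
      rfl
    rw [this]
  have e₁ : {S : (X ⧸ U) →ₗ[F] X // IsNilpotent (D + L S)} ≃ {T : Module.End F X //
      (IsNilpotent T ∧ MovesAlong e T) ∧ T (e (Fin.last j)) = 0} := by
    refine Equiv.ofBijective
      (fun S => ⟨T₀ + S.1 ∘ₗ U.mkQ, ⟨(hnil _).2 S.2, (hmov _).1⟩, (hmov _).2⟩) ⟨?_, ?_⟩
    · rintro ⟨S, _⟩ ⟨S', _⟩ h
      have h' : S ∘ₗ U.mkQ = S' ∘ₗ U.mkQ := add_left_cancel (Subtype.ext_iff.1 h)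
      exact Subtype.ext (Submodule.linearMap_qext _ h')
    · rintro ⟨T, ⟨hT, hTe⟩, hT'⟩
      have hker : U ≤ LinearMap.ker (T - T₀) := by
        rw [hU, Submodule.span_le]
        rintro _ ⟨i, rfl⟩
        simp only [SetLike.mem_coe, LinearMap.mem_ker, LinearMap.sub_apply]
        induction i using Fin.lastCases with
        | last => rw [hT', hT₀', sub_zero]
        | cast i => rw [hTe i, hT₀ i, sub_self]
      have hsum : T₀ + U.liftQ (T - T₀) hker ∘ₗ U.mkQ = T := by
        rw [Submodule.liftQ_mkQ, add_sub_cancel]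
      refine ⟨⟨U.liftQ (T - T₀) hker, (hnil _).1 (by rw [hsum]; exact hT)⟩, ?_⟩
      exact Subtype.ext hsum
  have e₂ : {S : Module.End F (X ⧸ U) // IsNilpotent (D + S)} ≃
      {S : Module.End F (X ⧸ U) // IsNilpotent S} :=
    (Equiv.addLeft D).subtypeEquiv fun _ => Iff.rfl
  have key := L.toAddMonoidHom.natCard_preimage_mul hL (fun S => IsNilpotent (D + S))
  rw [← Nat.card_congr e₁, ← Nat.card_congr e₂]
  have h₁ : Nat.card (Module.End F (X ⧸ U)) = Nat.card F ^ (c * c) := by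
    rw [Module.natCard_eq_pow_finrank (K := F), Module.finrank_linearMap, hfq]
  have h₂ : Nat.card ((X ⧸ U) →ₗ[F] X) = Nat.card F ^ (c * (j + 1 + c)) := by
    rw [Module.natCard_eq_pow_finrank (K := F), Module.finrank_linearMap, hfq, hc]
  rw [← h₁, ← h₂]
  exact key

variable [Finite F]

/-- The sum over the possible last images `w`: those outside the span of the chain contribute `B`
each, and those inside contribute only for `w = 0`. -/
theorem natCard_isNilpotent_movesAlong_add {X : Type v} [AddCommGroup X] [Module F X]
    [FiniteDimensional F X] {j c B : ℕ} (e : Fin (j + 1) → X) (he : LinearIndependent F e)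
    (hc : Module.finrank F X = j + 1 + c)
    (hY : Nat.card {T : Module.End F (X ⧸ Submodule.span F (Set.range e)) // IsNilpotent T} =
      Nat.card F ^ (c * (c - 1)))
    (hB : ∀ w ∉ Submodule.span F (Set.range e),
      Nat.card {T : Module.End F X //
        (IsNilpotent T ∧ MovesAlong e T) ∧ T (e (Fin.last j)) = w} = B) :
    Nat.card {T : Module.End F X // IsNilpotent T ∧ MovesAlong e T} + Nat.card F ^ (j + 1) * B =
      Nat.card F ^ (c * (j + c)) + Nat.card F ^ (j + 1 + c) * B := by
  classical
  have : Finite X := Module.finite_of_finite F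
  have : Finite (Module.End F X) := Module.finite_of_finite F
  have : Fintype X := Fintype.ofFinite X
  set U := Submodule.span F (Set.range e) with hU
  have hfr : Module.finrank F U = j + 1 := by
    rw [hU, finrank_span_eq_card he, Fintype.card_fin]
  have hzero : Nat.card {T : Module.End F X //
      (IsNilpotent T ∧ MovesAlong e T) ∧ T (e (Fin.last j)) = 0} =
      Nat.card F ^ (c * (j + c)) := by
    have hpos : 0 < Nat.card F ^ (c * c) := Nat.pow_pos Nat.card_pos
    refine Nat.eq_of_mul_eq_mul_right hpos ?_
    rw [natCard_isNilpotent_movesAlong_last_eq_zero e he hc, hY, ← pow_add, ← pow_add]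
    congr 1
    rcases c with _ | c
    · simp
    · simp only [Nat.add_sub_cancel]; ring
  -- correction terms on both sides put all `w` on the same footing and avoid subtraction
  have hterm : ∀ w : X, Nat.card {T : Module.End F X //
      (IsNilpotent T ∧ MovesAlong e T) ∧ T (e (Fin.last j)) = w} + (if w ∈ U then B else 0) =
      (if w = 0 then Nat.card F ^ (c * (j + c)) else 0) + B := by
    intro w
    by_cases hw : w ∈ U
    · by_cases hw0 : w = 0
      · subst hw0
        rw [hzero]
        simp
      · have : IsEmpty {T : Module.End F X //
            (IsNilpotent T ∧ MovesAlong e T) ∧ T (e (Fin.last j)) = w} := by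
          refine ⟨fun ⟨T, ⟨hT, hTe⟩, hTw⟩ => hw0 ?_⟩
          rw [← hTw]
          exact hTe.last_eq_zero he hT (hTw ▸ hw)
        simp [hw, hw0]
    · have hw0 : w ≠ 0 := fun h => hw (h ▸ U.zero_mem)
      simp [hB w hw, hw, hw0]
  have hsum := Finset.sum_congr (rfl : (Finset.univ : Finset X) = _) fun w _ => hterm w
  rw [Finset.sum_add_distrib, Finset.sum_add_distrib,
    ← natCard_subtype_eq_sum_fiber (fun T : Module.End F X => T (e (Fin.last j))),
    ← Finset.sum_filter, Finset.sum_const, Finset.sum_const, Finset.sum_ite_eq',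
    if_pos (Finset.mem_univ _), Finset.card_univ, ← Nat.card_eq_fintype_card,
    Module.natCard_eq_pow_finrank (K := F) (V := X), hc, ← Fintype.card_subtype,
    ← Nat.card_eq_fintype_card, smul_eq_mul, smul_eq_mul] at hsum
  have hcardU : Nat.card {x // x ∈ U} = Nat.card F ^ (j + 1) := by
    rw [Module.natCard_eq_pow_finrank (K := F), hfr]
  rwa [hcardU] at hsum

/-- The number of nilpotent endomorphisms of an `n`-dimensional space which move along a given
chain of `n - c` linearly independent vectors. -/
theorem natCard_isNilpotent_movesAlong {X : Type v} [AddCommGroup X] [Module F X]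
    [FiniteDimensional F X] {n : ℕ} (hn : Module.finrank F X = n)
    (ih : ∀ (Y : Type v) [AddCommGroup Y] [Module F Y] [FiniteDimensional F Y],
      Module.finrank F Y < n → Nat.card {T : Module.End F Y // IsNilpotent T} =
        Nat.card F ^ (Module.finrank F Y * (Module.finrank F Y - 1))) (c : ℕ) :
    ∀ {j : ℕ} (e : Fin (j + 1) → X), LinearIndependent F e → n = j + 1 + c →
      Nat.card {T : Module.End F X // IsNilpotent T ∧ MovesAlong e T} =
        Nat.card F ^ (n * c) := by
  have hY : ∀ {j c : ℕ} (e : Fin (j + 1) → X), LinearIndependent F e → n = j + 1 + c →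
      Nat.card {T : Module.End F (X ⧸ Submodule.span F (Set.range e)) // IsNilpotent T} =
        Nat.card F ^ (c * (c - 1)) := by
    intro j c e he hc
    have hfr : Module.finrank F (Submodule.span F (Set.range e)) = j + 1 := by
      rw [finrank_span_eq_card he, Fintype.card_fin]
    have hfq : Module.finrank F (X ⧸ Submodule.span F (Set.range e)) = c := by
      have := (Submodule.span F (Set.range e)).finrank_quotient_add_finrank
      omega
    rw [ih _ (by omega), hfq]
  induction c with
  | zero =>
    intro j e he hc
    have htop : Submodule.span F (Set.range e) = ⊤ :=
      he.span_eq_top_of_card_eq_finrank (by rw [Fintype.card_fin]; omega)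
    -- no vector lies outside the span, so that the value of `B` does not matter
    have := natCard_isNilpotent_movesAlong_add (B := 0) e he (hn.trans hc) (hY e he hc)
      fun w hw => (hw (htop ▸ Submodule.mem_top)).elim
    simpa using this
  | succ c ihc =>
    intro j e he hc
    have := natCard_isNilpotent_movesAlong_add (B := Nat.card F ^ (n * c)) e he (hn.trans hc)
      (hY e he hc) fun w hw => by
        have := ihc (Fin.snoc (α := fun _ => X) e w)
          (linearIndependent_finSnoc.2 ⟨he, hw⟩) (by omega)
        rw [← this]
        exact Nat.card_congr (Equiv.subtypeEquivRight fun T => by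
          rw [movesAlong_snoc_iff, and_assoc])
    have h₁ : Nat.card F ^ (j + 1) * Nat.card F ^ (n * c) =
        Nat.card F ^ ((c + 1) * (j + (c + 1))) := by
      rw [← pow_add, hc]
      congr 1
      ring
    have h₂ : Nat.card F ^ (j + 1 + (c + 1)) * Nat.card F ^ (n * c) =
        Nat.card F ^ (n * (c + 1)) := by
      rw [← pow_add, ← hc]
      congr 1
      ring
    omega

/-- The **Fine–Herstein theorem**: an `n`-dimensional vector space over a field with `q` elements
has `q ^ (n * (n - 1))` nilpotent endomorphisms. -/
theorem natCard_isNilpotent_end (X : Type v) [AddCommGroup X] [Module F X]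
    [FiniteDimensional F X] :
    Nat.card {T : Module.End F X // IsNilpotent T} =
      Nat.card F ^ (Module.finrank F X * (Module.finrank F X - 1)) := by
  induction hn : Module.finrank F X using Nat.strong_induction_on generalizing X with
  | _ n ih =>
    rcases n with _ | n
    · have : Subsingleton X := Module.finrank_zero_iff.1 hn
      have : Nonempty {T : Module.End F X // IsNilpotent T} := ⟨0, IsNilpotent.zero⟩
      simp
    · have : Nontrivial X := Module.nontrivial_of_finrank_pos (R := F) (by omega)
      obtain ⟨x, hx⟩ := exists_ne (0 : X)
      have := natCard_isNilpotent_movesAlong hn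
        (fun Y _ _ _ hY => ih _ hY Y rfl) n (j := 0) (fun _ => x)
        (LinearIndependent.of_subsingleton (ι := Fin 1) 0 hx) (by omega)
      rw [Nat.add_sub_cancel, ← this]
      exact Nat.card_congr (Equiv.subtypeEquivRight fun T => by simp [MovesAlong])

end Count

/-! ### Counting nilpotent pairs -/

section Pairs

variable {F V W : Type*} [Field F] [AddCommGroup V] [Module F V] [AddCommGroup W] [Module F W]

theorem natCard_apply_eq_zero_mul {v : V} (hv : v ≠ 0) :
    Nat.card {f : V →ₗ[F] W // f v = 0} * Nat.card W = Nat.card (V →ₗ[F] W) := by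
  have hL : Function.Surjective (LinearMap.applyₗ (R := F) (M₂ := W) v) := by
    intro w
    obtain ⟨φ, hφ⟩ := Module.Projective.exists_dual_ne_zero F hv
    exact ⟨(φ v)⁻¹ • φ.smulRight w, by simp [hφ]⟩
  have key := (LinearMap.applyₗ (R := F) (M₂ := W) v).toAddMonoidHom.natCard_preimage_mul hL
    (fun w => w = 0)
  simpa using key

variable [Finite F] [FiniteDimensional F V]

/-- With `I = range f` of dimension `r`, nilpotency of `g ∘ f` is that of the endomorphism of `I`
induced by `f ∘ g`, which depends linearly on `g` and can be any endomorphism of `I`.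
By the Fine–Herstein theorem a proportion `q ^ (-r) = |ker f| / |V|` of the maps `g` qualifies. -/
theorem natCard_isNilpotent_comp_mul (f : V →ₗ[F] W) :
    Nat.card {g : W →ₗ[F] V // IsNilpotent (g ∘ₗ f : Module.End F V)} * Nat.card V =
      Nat.card (W →ₗ[F] V) * Nat.card (LinearMap.ker f) := by
  let L : (W →ₗ[F] V) →ₗ[F] Module.End F (LinearMap.range f) :=
    LinearMap.compRight F f.rangeRestrict ∘ₗ
      LinearMap.lcomp F V (LinearMap.range f).subtype
  have hL : Function.Surjective L := by
    obtain ⟨s, hs⟩ := f.rangeRestrict.exists_rightInverse_of_surjective f.range_rangeRestrict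
    obtain ⟨p, hp⟩ := (LinearMap.range f).subtype.exists_leftInverse_of_injective
      (LinearMap.range f).ker_subtype
    refine fun S => ⟨s ∘ₗ S ∘ₗ p, ?_⟩
    change f.rangeRestrict ∘ₗ (s ∘ₗ S ∘ₗ p) ∘ₗ (LinearMap.range f).subtype = S
    rw [LinearMap.comp_assoc, LinearMap.comp_assoc, hp, LinearMap.comp_id,
      ← LinearMap.comp_assoc, hs, LinearMap.id_comp]
  have hnil : ∀ g : W →ₗ[F] V, IsNilpotent (g ∘ₗ f : Module.End F V) ↔ IsNilpotent (L g) :=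
    fun g => (LinearMap.isNilpotent_comp_swap_iff f.rangeRestrict
      (g ∘ₗ (LinearMap.range f).subtype)).symm
  have key := L.toAddMonoidHom.natCard_preimage_mul hL (fun S => IsNilpotent S)
  have hcong : Nat.card {g : W →ₗ[F] V // IsNilpotent (g ∘ₗ f : Module.End F V)} =
      Nat.card {g : W →ₗ[F] V // IsNilpotent (L.toAddMonoidHom g)} :=
    Nat.card_congr (Equiv.subtypeEquivRight hnil)
  rw [← hcong, natCard_isNilpotent_end, Module.natCard_eq_pow_finrank (K := F)
    (V := Module.End F (LinearMap.range f)), Module.finrank_linearMap] at key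
  rw [Module.natCard_eq_pow_finrank (K := F) (V := V),
    Module.natCard_eq_pow_finrank (K := F) (V := LinearMap.ker f),
    ← f.finrank_range_add_finrank_ker]
  set r := Module.finrank F (LinearMap.range f)
  set A := Nat.card {g : W →ₗ[F] V // IsNilpotent (g ∘ₗ f : Module.End F V)}
  have hr : r * r = r * (r - 1) + r := by
    rcases r with _ | r
    · rfl
    · rw [Nat.add_sub_cancel]; ring
  have hpos : 0 < Nat.card F ^ (r * (r - 1)) := Nat.pow_pos Nat.card_pos
  have key' : A * Nat.card F ^ r = Nat.card (W →ₗ[F] V) := by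
    refine Nat.eq_of_mul_eq_mul_left hpos ?_
    rw [← key, hr, pow_add]
    ring
  rw [pow_add, ← key']
  ring

/-- The number of pairs `(f, v)` with `f v = 0`, summed over `f`, and then over `v`. -/
theorem sum_natCard_ker_mul [Fintype (V →ₗ[F] W)] :
    (∑ f : V →ₗ[F] W, Nat.card (LinearMap.ker f)) * Nat.card W + Nat.card (V →ₗ[F] W) =
      Nat.card (V →ₗ[F] W) * (Nat.card V + Nat.card W) := by
  classical
  have : Finite V := Module.finite_of_finite F
  have : Fintype V := Fintype.ofFinite V
  have hswap : ∑ f : V →ₗ[F] W, Nat.card (LinearMap.ker f) =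
      ∑ v : V, Nat.card {f : V →ₗ[F] W // f v = 0} := by
    rw [← Nat.card_sigma, ← Nat.card_sigma]
    exact Nat.card_congr
      { toFun := fun x => ⟨x.2.1, x.1, x.2.2⟩
        invFun := fun x => ⟨x.2.1, x.1, x.2.2⟩
        left_inv := fun _ => rfl
        right_inv := fun _ => rfl }
  have hterm : ∀ v : V, Nat.card {f : V →ₗ[F] W // f v = 0} * Nat.card W +
      (if v = 0 then Nat.card (V →ₗ[F] W) else 0) =
      Nat.card (V →ₗ[F] W) +
        (if v = 0 then Nat.card (V →ₗ[F] W) * Nat.card W else 0) := by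
    intro v
    by_cases hv : v = 0
    · subst hv
      rw [Nat.card_congr (Equiv.subtypeUnivEquiv fun f : V →ₗ[F] W => map_zero f), if_pos rfl,
        if_pos rfl, add_comm]
    · rw [natCard_apply_eq_zero_mul hv, if_neg hv, if_neg hv]
  have hsum := Finset.sum_congr (rfl : (Finset.univ : Finset V) = _) fun v _ => hterm v
  rw [Finset.sum_add_distrib, Finset.sum_add_distrib, ← Finset.sum_mul, Finset.sum_ite_eq',
    Finset.sum_ite_eq', if_pos (Finset.mem_univ _), if_pos (Finset.mem_univ _),
    Finset.sum_const, Finset.card_univ, ← Nat.card_eq_fintype_card, smul_eq_mul,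
    ← hswap] at hsum
  rw [hsum]
  ring

variable [FiniteDimensional F W]

/-- The count of nilpotent pairs, with the subtraction in `|V| + |W| - 1` moved to the other
side. -/
theorem natCard_nilpotentPairs_mul :
    Nat.card (nilpotentPairs F V W) * (Nat.card V * Nat.card W) +
        Nat.card (V →ₗ[F] W) * Nat.card (W →ₗ[F] V) =
      Nat.card (V →ₗ[F] W) * Nat.card (W →ₗ[F] V) * (Nat.card V + Nat.card W) := by
  have : Finite (V →ₗ[F] W) := Module.finite_of_finite F
  have : Finite (W →ₗ[F] V) := Module.finite_of_finite F
  have : Fintype (V →ₗ[F] W) := Fintype.ofFinite _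
  have e : nilpotentPairs F V W ≃
      Σ f : V →ₗ[F] W, {g : W →ₗ[F] V // IsNilpotent (g ∘ₗ f : Module.End F V)} :=
    { toFun := fun p => ⟨p.1.1, p.1.2, p.2⟩
      invFun := fun x => ⟨(x.1, x.2.1), x.2.2⟩
      left_inv := fun _ => rfl
      right_inv := fun _ => rfl }
  have h : Nat.card (nilpotentPairs F V W) * Nat.card V =
      Nat.card (W →ₗ[F] V) * ∑ f : V →ₗ[F] W, Nat.card (LinearMap.ker f) := by
    rw [Nat.card_congr e, Nat.card_sigma, Finset.sum_mul, Finset.mul_sum]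
    exact Finset.sum_congr rfl fun f _ => natCard_isNilpotent_comp_mul f
  have h' := sum_natCard_ker_mul (F := F) (V := V) (W := W)
  calc _ = Nat.card (W →ₗ[F] V) *
        ((∑ f : V →ₗ[F] W, Nat.card (LinearMap.ker f)) * Nat.card W +
          Nat.card (V →ₗ[F] W)) := by
        rw [← mul_assoc, h]; ring
    _ = _ := by rw [h']; ring

theorem natCard_unionAlongZero_add_one :
    Nat.card (unionAlongZero F V W) + 1 = Nat.card V + Nat.card W := by
  have : Finite V := Module.finite_of_finite F
  have : Finite W := Module.finite_of_finite F
  have h := Set.ncard_union_add_ncard_inter (Set.range (LinearMap.inl F V W))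
    (Set.range (LinearMap.inr F V W)) (Set.toFinite _) (Set.toFinite _)
  have hinter : Set.range (LinearMap.inl F V W) ∩ Set.range (LinearMap.inr F V W) = {0} := by
    ext ⟨v, w⟩
    simp [Prod.ext_iff, eq_comm, and_comm]
  rw [hinter, Set.ncard_singleton, ← Nat.card_coe_set_eq, ← Nat.card_coe_set_eq,
    ← Nat.card_coe_set_eq, Nat.card_range_of_injective LinearMap.inl_injective,
    Nat.card_range_of_injective LinearMap.inr_injective] at h
  exact h

end Pairs

theorem mainTheorem1 {F V W : Type*} [Field F] [Finite F]
    [AddCommGroup V] [Module F V] [FiniteDimensional F V]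
    [AddCommGroup W] [Module F W] [FiniteDimensional F W]
    (q m n : ℕ) (hq : Nat.card F = q)
    (hm : Module.finrank F V = m) (hn : Module.finrank F W = n) :
    Nonempty
      (((V →ₗ[F] W) × (W →ₗ[F] V) × unionAlongZero F V W) ≃
        (nilpotentPairs F V W × V × W)) ∧
    (Nat.card (nilpotentPairs F V W) : ℚ) =
      (q : ℚ) ^ (2 * (m : ℤ) * n - m - n) * ((q : ℚ) ^ m + (q : ℚ) ^ n - 1) := by
  have : Finite V := Module.finite_of_finite F
  have : Finite W := Module.finite_of_finite F
  have : Finite (V →ₗ[F] W) := Module.finite_of_finite F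
  have : Finite (W →ₗ[F] V) := Module.finite_of_finite F
  have hpairs := natCard_nilpotentPairs_mul (F := F) (V := V) (W := W)
  have hunion := natCard_unionAlongZero_add_one (F := F) (V := V) (W := W)
  constructor
  · rw [← Finite.card_eq]
    simp only [Nat.card_prod]
    rw [← hunion, mul_add, mul_one, mul_assoc] at hpairs
    linarith
  · have hq0 : (q : ℚ) ≠ 0 := by
      rw [← hq]
      exact_mod_cast Nat.card_pos.ne'
    rw [Module.natCard_eq_pow_finrank (K := F) (V := V),
      Module.natCard_eq_pow_finrank (K := F) (V := W),
      Module.natCard_eq_pow_finrank (K := F) (V := V →ₗ[F] W),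
      Module.natCard_eq_pow_finrank (K := F) (V := W →ₗ[F] V), Module.finrank_linearMap,
      Module.finrank_linearMap, hm, hn, hq] at hpairs
    have hpairs' : (Nat.card (nilpotentPairs F V W) : ℚ) * ((q : ℚ) ^ m * (q : ℚ) ^ n) +
        (q : ℚ) ^ (m * n) * (q : ℚ) ^ (n * m) =
        (q : ℚ) ^ (m * n) * (q : ℚ) ^ (n * m) * ((q : ℚ) ^ m + (q : ℚ) ^ n) := by
      exact_mod_cast hpairs
    have hexp : (q : ℚ) ^ (2 * (m : ℤ) * n - m - n) =
        (q : ℚ) ^ (m * n) * (q : ℚ) ^ (n * m) / ((q : ℚ) ^ m * (q : ℚ) ^ n) := by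
      rw [zpow_sub₀ hq0, zpow_sub₀ hq0, div_div, zpow_natCast, zpow_natCast,
        ← pow_add _ (m * n), ← zpow_natCast (q : ℚ) (m * n + n * m)]
      congr 2
      push_cast
      ring
    rw [hexp, div_mul_eq_mul_div, eq_div_iff (by positivity)]
    linarith
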